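/- Let $(\xi_k)_{k\ge 1}$ be independent random variables on a probability space $(\Omega,\mathcal A,\mathbb P)$ with values in $\{0,1\}$ and $\mathbb E(\xi_k)=\frac{\log k}{k}$, and let $T=T(\omega)=\{k\ge 1:\xi_k(\omega)=1\}$ be the associated random set of integers. For each integer $n\ge 0$ let $I_n=[2^n,2^{n+1})\cap\mathbb N$ and $T_{I_n}=T\cap I_n$. Let $e_k(x)=e^{2i\pi kx}$ on $\mathbb T=\mathbb R/\mathbb Z$ with Lebesgue measure $m$ and, for a finite set $A$ of positive integers, let $$\psi_A=\Big\|\sum_{k\in A}e_k\Big\|_{\psi_2},\qquad \|f\|_{\psi_2}=\inf\Big\{r>0:\int_{\mathbb T}\big(e^{|f|^2/r^2}-1\big)\,dm\le 1\Big\}.$$ Then, for almost every $\omega$, the following two assertions hold. 1. $|T_{I_n}|\asymp n$ as $n\to\infty$, that is, there are $c,c'>0$ and $n_0$ (which may depend on $\omega$) such that $c\,n\le |T_{I_n}|\le c'\,n$ for all $n\ge n_0$. 2. There is a constant $C=C(\omega)>0$, independent of $n$, such that $\psi_{T_{I_n}}\le C\,|T_{I_n}|^{1/2}$ for every $n$.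 -/

import Mathlib

open MeasureTheory ProbabilityTheory Filter Asymptotics
open scoped ENNReal NNReal

/-- The Luxemburg norm of `f` in the Orlicz space attached to the Orlicz function `Φ` and the
measure `μ`: the infimum of the `r > 0` such that `∫ Φ (‖f‖ / r) dμ ≤ 1` (it is `∞` if there is
no such `r`). -/
noncomputable def orliczNorm {α E : Type*} [MeasurableSpace α] [Norm E]
    (Φ : ℝ → ℝ) (μ : Measure α) (f : α → E) : ℝ≥0∞ :=
  ⨅ (r : ℝ≥0) (_ : 0 < r) (_ : ∫⁻ x, ENNReal.ofReal (Φ (‖f x‖ / r)) ∂μ ≤ 1), (r : ℝ≥0∞)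

/-- The Gaussian Orlicz function `ψ₂ x = exp (x ^ 2) - 1`. -/
noncomputable def gaussOrlicz (x : ℝ) : ℝ := Real.exp (x ^ 2) - 1

/-- `ψ_A = ‖∑ k ∈ A, e_k‖_{ψ₂}` for a finite set `A` of integers, where
`e_k x = exp (2 * π * i * k * x)` on the circle `ℝ / ℤ` with Lebesgue measure. -/
noncomputable def psiNorm (A : Finset ℕ) : ℝ≥0∞ :=
  orliczNorm gaussOrlicz (volume : Measure UnitAddCircle)
    (fun x : UnitAddCircle => ∑ k ∈ A, (fourier (k : ℤ) x : ℂ))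

open Classical in
/-- `Λ ∩ I_n`, where `I_n = [2 ^ n, 2 ^ (n + 1))` is the `n`-th dyadic block. -/
noncomputable def blockPart (Λ : Set ℕ) (n : ℕ) : Finset ℕ :=
  (Finset.Ico (2 ^ n) (2 ^ (n + 1))).filter (fun k => k ∈ Λ)

/-- The random set `{k ≥ 1 : ξ_k = 1}` at the sample point `ω`. -/
def randomSet {Ω : Type*} (ξ : ℕ → Ω → ℝ) (ω : Ω) : Set ℕ :=
  {k | 1 ≤ k ∧ ξ k ω = 1}

/-- `(ξ_k)`, `k ≥ 1`, are independent random variables with values in `{0, 1}` and expectations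
`𝔼 ξ_k = log k / k`. Nothing is required of `ξ 0`, which plays no role. -/
structure IsLogSelectors {Ω : Type*} [MeasurableSpace Ω] (P : Measure Ω)
    (ξ : ℕ → Ω → ℝ) : Prop where
  measurable : ∀ k, 1 ≤ k → Measurable (ξ k)
  zero_or_one : ∀ k, 1 ≤ k → ∀ ω, ξ k ω = 0 ∨ ξ k ω = 1
  indep : iIndepFun (fun k : {k : ℕ // 1 ≤ k} => ξ k) P
  mean : ∀ k, 1 ≤ k → ∫ ω, ξ k ω ∂P = Real.log k / k

/-! The `ψ₂` bound is a Riesz product argument. For selectors `b i ∈ {0, 1}` with `N = ∑ b i`,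
convexity of `exp` bounds `exp (t * ∑ b i * v i)` by `exp (t² N / 2)` times a Riesz product, whose
integral is at most the number of relations `∑ ε i * ν i = 0`, each weighted by the coefficients it
uses (`integral_riesz_product_le`). If this weighted count is at most 2, the exponential sum is
sub-Gaussian with variance of order `N`, hence has `ψ₂` norm at most `8 √N`.

Randomness makes the count small. By independence its expectation is the same count with the
selectors replaced by their means. In a relation among distinct positive frequencies, any one term
is determined by the others, so in the block `I_n` the nonzero relations weigh at most (largest
weight) × (total weight of all sign vectors), that is about `n 2⁻ⁿ · 2^(n/2)` (`relationSum_le`).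
This is summable, so Markov and Borel–Cantelli apply; the finitely many remaining blocks only affect
the constant.

For the cardinality, the means over `I_n` sum to order `n`, so Chernoff bounds decay geometrically
and Borel–Cantelli gives both estimates. -/

/-- The sum of `∏_{ε i ≠ 0} w i` over all sign vectors `ε` with `∑ ε i * ν i = 0`. -/
noncomputable def relationSum {ι : Type*} [Fintype ι] [DecidableEq ι] (ν : ι → ℤ) (w : ι → ℝ) : ℝ :=
  ∑ ε : ι → SignType with ∑ i, (ε i : ℤ) * ν i = 0, ∏ i, if ε i = 0 then 1 else w i

/-! ### Weighted relations and Riesz products -/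

section Relations

variable {ι : Type*} [Fintype ι] [DecidableEq ι] {ν : ι → ℤ} {w : ι → ℝ}

theorem sum_signType {M : Type*} [AddCommMonoid M] (f : SignType → M) :
    ∑ s, f s = f 0 + f (-1) + f 1 := by
  have : (Finset.univ : Finset SignType) = {0, -1, 1} := by decide
  rw [this, Finset.sum_insert (by decide), Finset.sum_insert (by decide), Finset.sum_singleton,
    add_assoc]

theorem sum_signs_prod (w : ι → ℝ) :
    ∑ ε : ι → SignType, ∏ i, (if ε i = 0 then 1 else w i) = ∏ i, (1 + 2 * w i) := by
  rw [← Fintype.prod_sum (fun i (s : SignType) => if s = 0 then (1 : ℝ) else w i)]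
  refine Finset.prod_congr rfl fun i _ => ?_
  rw [sum_signType]
  simp
  ring

omit [DecidableEq ι] in
theorem signs_prod_nonneg (hw : ∀ i, 0 ≤ w i) (ε : ι → SignType) :
    0 ≤ ∏ i, (if ε i = 0 then 1 else w i) :=
  Finset.prod_nonneg fun i _ => by split_ifs <;> simp [hw]

theorem relationSum_mono {v : ι → ℝ} (hw : ∀ i, 0 ≤ w i) (hv : ∀ i, w i ≤ v i) :
    relationSum ν w ≤ relationSum ν v := by
  refine Finset.sum_le_sum fun ε _ => Finset.prod_le_prod (fun i _ => ?_) fun i _ => ?_ <;>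
    split_ifs <;> simp [hw, hv]

theorem relationSum_eq (ν : ι → ℤ) (w : ι → ℝ) :
    relationSum ν w = 1 + ∑ ε : ι → SignType with (∑ i, (ε i : ℤ) * ν i = 0 ∧ ε ≠ 0),
      ∏ i, if ε i = 0 then 1 else w i := by
  rw [relationSum, ← Finset.filter_filter, Finset.filter_ne' _ (0 : ι → SignType),
    ← Finset.add_sum_erase _ _ (show (0 : ι → SignType) ∈ _ by simp)]
  simp

theorem one_le_relationSum (hw : ∀ i, 0 ≤ w i) : 1 ≤ relationSum ν w := by
  rw [relationSum_eq]
  exact le_add_of_nonneg_right (Finset.sum_nonneg fun ε _ => signs_prod_nonneg hw ε)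

/-- A relation determines the erased term `ε i * ν i` as minus the sum of the others. Since the `ν
i` are positive and distinct, this value gives back both the sign and the index, even when the two
erased indices are not assumed equal. -/
theorem signs_eq_of_update_eq (hν : Function.Injective ν) (hpos : ∀ i, 0 < ν i)
    {ε δ : ι → SignType} {i j : ι} (hε : ∑ k, (ε k : ℤ) * ν k = 0)
    (hδ : ∑ k, (δ k : ℤ) * ν k = 0) (hi : ε i ≠ 0) (hj : δ j ≠ 0)
    (h : Function.update ε i 0 = Function.update δ j 0) : ε = δ := by
  have key : ∀ (η : ι → SignType) (m : ι), ∑ k, (η k : ℤ) * ν k = 0 →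
      (η m : ℤ) * ν m = - ∑ k, (Function.update η m 0 k : ℤ) * ν k := by
    intro η m hη
    rw [← Finset.add_sum_erase _ _ (Finset.mem_univ m)] at hη
    rw [← Finset.add_sum_erase _ (fun k => (Function.update η m 0 k : ℤ) * ν k)
      (Finset.mem_univ m)]
    have : ∑ k ∈ Finset.univ.erase m, (Function.update η m 0 k : ℤ) * ν k =
        ∑ k ∈ Finset.univ.erase m, (η k : ℤ) * ν k :=
      Finset.sum_congr rfl fun k hk => by
        rw [Function.update_of_ne (Finset.ne_of_mem_erase hk)]
    rw [this, Function.update_self, SignType.coe_zero, zero_mul, zero_add]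
    linarith
  have e : (ε i : ℤ) * ν i = (δ j : ℤ) * ν j := by rw [key ε i hε, key δ j hδ, h]
  have hsign : ε i = δ j ∧ ν i = ν j := by
    have h1 := hpos i
    have h2 := hpos j
    rcases SignType.trichotomy (ε i) with h3 | h3 | h3 <;>
      rcases SignType.trichotomy (δ j) with h4 | h4 | h4 <;>
      simp only [h3, h4, ne_eq, not_true_eq_false, SignType.coe_neg_one, SignType.coe_one] at e hi hj ⊢ <;>
      first | omega | simpa using e
  have hij : i = j := hν hsign.2
  subst hij
  funext k
  by_cases hk : k = i
  · subst hk; exact hsign.1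
  · have := congrFun h k
    rwa [Function.update_of_ne hk, Function.update_of_ne hk] at this

/-- Erasing one nonzero coordinate from each nonzero relation is injective and costs a factor `w i ≤
q`; the images are then counted among all sign vectors. -/
theorem relationSum_le (hν : Function.Injective ν) (hpos : ∀ i, 0 < ν i) {q : ℝ}
    (hw : ∀ i, 0 ≤ w i) (hq : ∀ i, w i ≤ q) (hq0 : 0 ≤ q) :
    relationSum ν w ≤ 1 + q * ∏ i, (1 + 2 * w i) := by
  rw [relationSum_eq, ← sum_signs_prod]
  gcongr
  set S : Finset (ι → SignType) :=
    Finset.univ.filter fun ε => ∑ i, (ε i : ℤ) * ν i = 0 ∧ ε ≠ 0 with hS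
  rcases isEmpty_or_nonempty ι with hι | hι
  · have : S = ∅ := Finset.filter_false_of_mem fun ε _ h => h.2 (Subsingleton.elim _ _)
    simp [this, hq0]
  have hex : ∀ ε ∈ S, ∃ i, ε i ≠ 0 := fun ε hε => Function.ne_iff.1 (Finset.mem_filter.1 hε).2.2
  choose! f hf using hex
  set g : (ι → SignType) → (ι → SignType) := fun ε => Function.update ε (f ε) 0 with hg
  have hinj : Set.InjOn g S := fun ε hε δ hδ h =>
    signs_eq_of_update_eq hν hpos (Finset.mem_filter.1 hε).2.1 (Finset.mem_filter.1 hδ).2.1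
      (hf ε hε) (hf δ hδ) h
  calc ∑ ε ∈ S, ∏ i, (if ε i = 0 then 1 else w i)
      ≤ ∑ ε ∈ S, q * ∏ i, (if g ε i = 0 then 1 else w i) := by
        refine Finset.sum_le_sum fun ε hε => ?_
        rw [← Finset.mul_prod_erase _ _ (Finset.mem_univ (f ε)), if_neg (hf ε hε)]
        have : ∏ i, (if g ε i = 0 then 1 else w i) =
            ∏ i ∈ Finset.univ.erase (f ε), (if ε i = 0 then 1 else w i) := by
          rw [← Finset.mul_prod_erase _ _ (Finset.mem_univ (f ε))]
          simp only [hg, Function.update_self, if_true, one_mul]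
          refine Finset.prod_congr rfl fun i hi => ?_
          rw [Function.update_of_ne (Finset.ne_of_mem_erase hi)]
        rw [this]
        exact mul_le_mul_of_nonneg_right (hq _)
          (Finset.prod_nonneg fun i _ => by split_ifs <;> simp [hw])
    _ = q * ∑ ε ∈ S.image g, ∏ i, (if ε i = 0 then 1 else w i) := by
        rw [Finset.sum_image hinj, Finset.mul_sum]
    _ ≤ q * ∑ ε : ι → SignType, ∏ i, (if ε i = 0 then 1 else w i) := by
        gcongr
        · exact fun ε _ _ => signs_prod_nonneg hw ε
        · exact Finset.subset_univ _

theorem integral_unitAddCircle_fourier (n : ℤ) :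
    ∫ x : UnitAddCircle, (fourier n x : ℂ) = if n = 0 then 1 else 0 := by
  have h := congrFun (fourierCoeff_fourier (T := 1) n) 0
  simp only [fourierCoeff, neg_zero, fourier_zero, one_smul] at h
  rw [AddCircle.integral_haarAddCircle] at h
  simpa [Pi.single_apply, eq_comm] using h

omit [Fintype ι] in
theorem prod_fourier {T : ℝ} (s : Finset ι) (n : ι → ℤ) (x : AddCircle T) :
    ∏ i ∈ s, (fourier (n i) x : ℂ) = fourier (∑ i ∈ s, n i) x := by
  induction s using Finset.induction_on with
  | empty => simp
  | insert a s ha ih => rw [Finset.prod_insert ha, Finset.sum_insert ha, fourier_add, ih]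

/-- Expanding the product, only characters of frequency 0 survive integration, and these are the
relations. The rotation `z` changes each coefficient by a unimodular factor only. -/
theorem integral_riesz_product_le (ν : ι → ℤ) (hw : ∀ i, 0 ≤ w i) {z : ℂ} (hz : ‖z‖ = 1) :
    ∫ x : UnitAddCircle, ∏ i, (1 + 2 * w i * (z * fourier (ν i) x).re) ≤ relationSum ν w := by
  set c : ι → SignType → ℂ := fun i s =>
    if s = 0 then 1 else (w i : ℂ) * (if s = 1 then z else (starRingEnd ℂ) z) with hc
  have hexp : ∀ x : UnitAddCircle, ((∏ i, (1 + 2 * w i * (z * fourier (ν i) x).re) : ℝ) : ℂ) =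
      ∑ ε : ι → SignType, (∏ i, c i (ε i)) * fourier (∑ i, (ε i : ℤ) * ν i) x := by
    intro x
    simp_rw [← prod_fourier, ← Finset.prod_mul_distrib]
    rw [← Fintype.prod_sum (fun i (s : SignType) => c i s * fourier ((s : ℤ) * ν i) x)]
    push_cast
    refine Finset.prod_congr rfl fun i _ => ?_
    rw [sum_signType, Complex.re_eq_add_conj]
    simp only [hc, SignType.coe_zero, zero_mul, fourier_zero, SignType.coe_neg_one, neg_mul, one_mul,
      SignType.coe_one, fourier_neg, map_mul, if_true, if_neg (show (-1 : SignType) ≠ 0 by decide),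
      if_neg (show (-1 : SignType) ≠ 1 by decide), if_neg (show (1 : SignType) ≠ 0 by decide)]
    ring
  have hint : ((∫ x : UnitAddCircle, ∏ i, (1 + 2 * w i * (z * fourier (ν i) x).re) : ℝ) : ℂ) =
      ∑ ε : ι → SignType with ∑ i, (ε i : ℤ) * ν i = 0, ∏ i, c i (ε i) := by
    rw [← integral_complex_ofReal]
    simp_rw [hexp]
    rw [integral_finsetSum]
    · simp_rw [integral_const_mul, integral_unitAddCircle_fourier]
      simp [Finset.sum_filter]
    · intro ε _
      exact (Continuous.integrable_of_hasCompactSupport (by fun_prop)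
        (HasCompactSupport.of_compactSpace _))
  calc _ ≤ ‖((∫ x : UnitAddCircle, ∏ i, (1 + 2 * w i * (z * fourier (ν i) x).re) : ℝ) : ℂ)‖ := by
        rw [Complex.norm_real]; exact le_abs_self _
    _ ≤ _ := by
        rw [hint]
        refine (norm_sum_le _ _).trans (Finset.sum_le_sum fun ε _ => ?_)
        rw [norm_prod]
        refine Finset.prod_le_prod (fun i _ => norm_nonneg _) fun i _ => ?_
        simp only [hc]
        split_ifs <;> simp [hz, abs_of_nonneg (hw i)]

end Relations


/-! ### From Laplace transforms to the `ψ₂` norm -/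

section Orlicz

theorem orliczNorm_le {α E : Type*} [MeasurableSpace α] [Norm E] {Φ : ℝ → ℝ} {μ : Measure α}
    {f : α → E} {r : ℝ} (hr : 0 < r)
    (h : ∫⁻ x, ENNReal.ofReal (Φ (‖f x‖ / r)) ∂μ ≤ 1) :
    orliczNorm Φ μ f ≤ ENNReal.ofReal r := by
  refine iInf_le_of_le r.toNNReal (iInf_le_of_le (Real.toNNReal_pos.2 hr) (iInf_le_of_le ?_ le_rfl))
  rwa [Real.coe_toNNReal _ hr.le]

variable {α : Type*} [MeasurableSpace α] {μ : Measure α} [IsProbabilityMeasure μ]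

theorem lintegral_exp_mul_sub_sq {N : ℝ} (hN : 0 < N) (u : ℝ) :
    ∫⁻ t : ℝ, ENNReal.ofReal (Real.exp (t * u - 4 * N * t ^ 2)) =
      ENNReal.ofReal (Real.exp (u ^ 2 / (16 * N)) * √(Real.pi / (4 * N))) := by
  have h1 : ∀ t : ℝ, Real.exp (t * u - 4 * N * t ^ 2) =
      Real.exp (u ^ 2 / (16 * N)) * Real.exp (-(4 * N) * (t - u / (8 * N)) ^ 2) := by
    intro t
    rw [← Real.exp_add]
    congr 1
    field_simp
    ring
  have hint : Integrable fun t : ℝ => Real.exp (-(4 * N) * t ^ 2) :=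
    integrable_exp_neg_mul_sq (by positivity)
  simp_rw [h1]
  rw [← ofReal_integral_eq_lintegral_ofReal ((hint.comp_sub_right _).const_mul _)
    (ae_of_all _ fun t => by positivity), integral_const_mul,
    integral_sub_right_eq_self (fun t : ℝ => Real.exp (-(4 * N) * t ^ 2)), integral_gaussian]

/-- Integrating `exp (t * u)` in `t` against a Gaussian weight produces `exp (u² / (16 N))`; the
weight `exp (-4 N t²)` beats the growth `exp (2 N t²)` of the hypothesis. -/
theorem lintegral_exp_sq_le {u : α → ℝ} (hu : Measurable u) {N : ℝ} (hN : 0 < N)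
    (h : ∀ t : ℝ, ∫⁻ x, ENNReal.ofReal (Real.exp (t * u x)) ∂μ ≤
      ENNReal.ofReal (2 * Real.exp (2 * t ^ 2 * N))) :
    ∫⁻ x, ENNReal.ofReal (Real.exp (u x ^ 2 / (16 * N))) ∂μ ≤ 3 := by
  set K := √(Real.pi / (4 * N)) with hK
  have hKpos : 0 < K := Real.sqrt_pos.2 (by positivity)
  have hint : Integrable fun t : ℝ => Real.exp (-(2 * N) * t ^ 2) :=
    integrable_exp_neg_mul_sq (by positivity)
  have key : (∫⁻ x, ENNReal.ofReal (Real.exp (u x ^ 2 / (16 * N))) ∂μ) * ENNReal.ofReal K ≤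
      3 * ENNReal.ofReal K := by
    calc _ = ∫⁻ x, (∫⁻ t : ℝ, ENNReal.ofReal (Real.exp (t * u x - 4 * N * t ^ 2))) ∂μ := by
          rw [← lintegral_mul_const _ (by fun_prop)]
          refine lintegral_congr fun x => ?_
          rw [lintegral_exp_mul_sub_sq hN, ENNReal.ofReal_mul (by positivity)]
      _ = ∫⁻ t : ℝ, ∫⁻ x, ENNReal.ofReal (Real.exp (t * u x - 4 * N * t ^ 2)) ∂μ :=
          by
          refine lintegral_lintegral_swap (Measurable.aemeasurable ?_)
          simp only [Function.uncurry_def]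
          fun_prop
      _ ≤ ∫⁻ t : ℝ, ENNReal.ofReal (2 * Real.exp (-(2 * N) * t ^ 2)) := by
          refine lintegral_mono fun t => ?_
          calc _ = ∫⁻ x, ENNReal.ofReal (Real.exp (t * u x)) *
                ENNReal.ofReal (Real.exp (-(4 * N * t ^ 2))) ∂μ := by
                refine lintegral_congr fun x => ?_
                rw [← ENNReal.ofReal_mul (by positivity), ← Real.exp_add, sub_eq_add_neg]
            _ ≤ ENNReal.ofReal (2 * Real.exp (2 * t ^ 2 * N)) *
                ENNReal.ofReal (Real.exp (-(4 * N * t ^ 2))) := by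
                rw [lintegral_mul_const _ (by fun_prop)]
                gcongr
                exact h t
            _ = _ := by
                rw [← ENNReal.ofReal_mul (by positivity), mul_assoc, ← Real.exp_add]
                ring_nf
      _ = ENNReal.ofReal (2 * √(Real.pi / (2 * N))) := by
          rw [← ofReal_integral_eq_lintegral_ofReal (hint.const_mul _)
            (ae_of_all _ fun t => by positivity), integral_const_mul, integral_gaussian]
      -- The left side is `2√2 K`, and `2√2 ≤ 3`.
      _ ≤ ENNReal.ofReal (3 * K) := by
          refine ENNReal.ofReal_le_ofReal ?_
          refine le_of_sq_le_sq ?_ (by positivity)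
          rw [mul_pow, mul_pow, hK, Real.sq_sqrt (by positivity), Real.sq_sqrt (by positivity)]
          have : Real.pi / (2 * N) = 2 * (Real.pi / (4 * N)) := by field_simp; norm_num
          rw [this]
          have : 0 < Real.pi / (4 * N) := by positivity
          linarith
      _ = 3 * ENNReal.ofReal K := by rw [ENNReal.ofReal_mul (by norm_num)]; simp
  exact (ENNReal.mul_le_mul_iff_left (by simpa using hKpos) ENNReal.ofReal_ne_top).1 key

/-- Sub-Gaussian Laplace transforms in all complex directions bound the `ψ₂` norm. -/
theorem orliczNorm_gaussOrlicz_le {f : α → ℂ} (hf : Measurable f) {N : ℝ} (hN : 0 < N)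
    (h : ∀ z : ℂ, ‖z‖ = 1 → ∀ t : ℝ, ∫⁻ x, ENNReal.ofReal (Real.exp (t * (z * f x).re)) ∂μ ≤
      ENNReal.ofReal (2 * Real.exp (2 * t ^ 2 * N))) :
    orliczNorm gaussOrlicz μ f ≤ ENNReal.ofReal (8 * √N) := by
  have hs : 0 < √N := Real.sqrt_pos.2 hN
  refine orliczNorm_le (by positivity) ?_
  have h1 := lintegral_exp_sq_le (μ := μ) (u := fun x => (f x).re) (by fun_prop) hN
    (by simpa using h 1 (by simp))
  have h2 := lintegral_exp_sq_le (μ := μ) (u := fun x => (f x).im) (by fun_prop) hN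
    (by simpa using h (-Complex.I) (by simp))
  -- With `a`, `b` the exponentials at scale `64 N`: `ab ≤ (a² + b²) / 2 ≤ (a⁴ + b⁴) / 4 + 1 / 2`,
  -- and fourth powers return to scale `16 N`. The bounds by 3 then integrate to `6 / 4 = 1 + 1 /
  -- 2`.
  have hpt : ∀ x, gaussOrlicz (‖f x‖ / (8 * √N)) + 1 / 2 ≤
      (Real.exp ((f x).re ^ 2 / (16 * N)) + Real.exp ((f x).im ^ 2 / (16 * N))) / 4 := by
    intro x
    have e : (‖f x‖ / (8 * √N)) ^ 2 = (f x).re ^ 2 / (64 * N) + (f x).im ^ 2 / (64 * N) := by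
      rw [div_pow, mul_pow, Real.sq_sqrt hN.le, Complex.sq_norm, Complex.normSq_apply]
      ring
    have e4 : ∀ y : ℝ, Real.exp (y / (16 * N)) = Real.exp (y / (64 * N)) ^ 4 := by
      intro y
      rw [← Real.exp_nat_mul]
      congr 1
      field_simp
      ring
    rw [gaussOrlicz, e, Real.exp_add, e4, e4]
    set a := Real.exp ((f x).re ^ 2 / (64 * N))
    set b := Real.exp ((f x).im ^ 2 / (64 * N))
    nlinarith [sq_nonneg (a - b), sq_nonneg (a ^ 2 - 1), sq_nonneg (b ^ 2 - 1)]
  have hnn : ∀ y : ℝ, 0 ≤ gaussOrlicz y := fun y => by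
    have := Real.one_le_exp (sq_nonneg y)
    rw [gaussOrlicz]; linarith
  have hsum : ∫⁻ x, ENNReal.ofReal (gaussOrlicz (‖f x‖ / (8 * √N))) ∂μ + ENNReal.ofReal (1 / 2) ≤
      1 + ENNReal.ofReal (1 / 2) := by
    calc _ = ∫⁻ x, ENNReal.ofReal (gaussOrlicz (‖f x‖ / (8 * √N)) + 1 / 2) ∂μ := by
          simp_rw [ENNReal.ofReal_add (hnn _) (show (0 : ℝ) ≤ 1 / 2 by norm_num)]
          rw [lintegral_add_right _ measurable_const]
          simp
      _ ≤ ∫⁻ x, ENNReal.ofReal (1 / 4) * (ENNReal.ofReal (Real.exp ((f x).re ^ 2 / (16 * N))) +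
            ENNReal.ofReal (Real.exp ((f x).im ^ 2 / (16 * N)))) ∂μ := by
          refine lintegral_mono fun x => ?_
          dsimp only
          rw [← ENNReal.ofReal_add (by positivity) (by positivity),
            ← ENNReal.ofReal_mul (by norm_num)]
          exact ENNReal.ofReal_le_ofReal ((hpt x).trans_eq (by ring))
      _ ≤ ENNReal.ofReal (1 / 4) * (3 + 3) := by
          rw [lintegral_const_mul _ (by fun_prop), lintegral_add_left (by fun_prop)]
          gcongr
      _ = 1 + ENNReal.ofReal (1 / 2) := by
          rw [show (3 + 3 : ℝ≥0∞) = ENNReal.ofReal 6 by norm_num,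
            ← ENNReal.ofReal_mul (by norm_num), ← ENNReal.ofReal_one,
            ← ENNReal.ofReal_add (by norm_num) (by norm_num)]
          norm_num
  exact (ENNReal.add_le_add_iff_right ENNReal.ofReal_ne_top).1 hsum

end Orlicz

/-! ### Sub-Gaussian bound for a selected exponential sum -/

section Selectors

variable {ι : Type*} [Fintype ι] [DecidableEq ι] {ν : ι → ℤ} {b : ι → ℝ}

omit [DecidableEq ι] in
-- On `[-1, 1]` the exponential lies below its chord, `exp (t v) ≤ cosh t * (1 + v tanh t)`, and
-- `cosh t ≤ exp (t² / 2)`.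
theorem exp_sum_le_riesz_product (hb : ∀ i, b i = 0 ∨ b i = 1) {v : ι → ℝ} (hv : ∀ i, |v i| ≤ 1)
    (t : ℝ) : Real.exp (t * ∑ i, b i * v i) ≤
      Real.exp (t ^ 2 * (∑ i, b i) / 2) * ∏ i, (1 + 2 * (b i * (Real.tanh t / 2)) * v i) := by
  have hpos : ∀ i, 0 ≤ 1 + 2 * (b i * (Real.tanh t / 2)) * v i := by
    intro i
    have h1 : |Real.tanh t * v i| ≤ 1 := by
      rw [abs_mul]
      exact mul_le_one₀ (Real.abs_tanh_lt_one t).le (abs_nonneg _) (hv i)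
    rcases hb i with h | h <;> rw [h]
    · norm_num
    · linarith [(abs_le.1 h1).1]
  rw [Finset.mul_sum, Real.exp_sum, Finset.mul_sum, Finset.sum_div, Real.exp_sum,
    ← Finset.prod_mul_distrib]
  refine Finset.prod_le_prod (fun i _ => (Real.exp_pos _).le) fun i _ => ?_
  rcases hb i with h | h
  · simp [h]
  · rw [h, one_mul, mul_one, mul_comm t]
    have h2 : 0 ≤ 1 + 2 * (1 * (Real.tanh t / 2)) * v i := by simpa [h] using hpos i
    have hc := Real.cosh_pos t
    calc Real.exp (v i * t) ≤ Real.cosh t + v i * Real.sinh t :=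
          Real.exp_mul_le_cosh_add_mul_sinh (hv i) t
      _ = Real.cosh t * (1 + 2 * (1 * (Real.tanh t / 2)) * v i) := by
          rw [Real.tanh_eq_sinh_div_cosh]; field_simp
      _ ≤ _ := mul_le_mul_of_nonneg_right (Real.cosh_le_exp_half_sq t) h2

theorem integral_exp_fourier_sum_le (hb : ∀ i, b i = 0 ∨ b i = 1)
    (hW : relationSum ν (fun i => b i / 4) ≤ 2) {z : ℂ} (hz : ‖z‖ = 1) (t : ℝ) :
    ∫ x : UnitAddCircle, Real.exp (t * (z * ∑ i, b i * fourier (ν i) x).re) ≤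
      2 * Real.exp (2 * t ^ 2 * ∑ i, b i) := by
  -- The sign of `t` is absorbed into `z`.
  wlog ht : 0 ≤ t generalizing t z
  · have := this (z := -z) (by simpa using hz) (-t) (by linarith)
    simpa only [neg_mul, Complex.neg_re, mul_neg, neg_neg, neg_sq] using this
  have hb0 : ∀ i, 0 ≤ b i := fun i => by rcases hb i with h | h <;> simp [h]
  have hN : 0 ≤ ∑ i, b i := Finset.sum_nonneg fun i _ => hb0 i
  have hre : ∀ x : UnitAddCircle, (z * ∑ i, b i * fourier (ν i) x).re =
      ∑ i, b i * (z * fourier (ν i) x).re := by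
    intro x
    rw [Finset.mul_sum, Complex.re_sum]
    refine Finset.sum_congr rfl fun i _ => ?_
    rw [mul_left_comm, Complex.re_ofReal_mul]
  have hv : ∀ (x : UnitAddCircle) i, |(z * fourier (ν i) x).re| ≤ 1 := fun x i =>
    (Complex.abs_re_le_norm _).trans
      (by rw [norm_mul, hz, one_mul, fourier_apply, Circle.norm_coe])
  have hcont : ∀ g : UnitAddCircle → ℝ, Continuous g → Integrable g := fun g hg =>
    hg.integrable_of_hasCompactSupport (HasCompactSupport.of_compactSpace _)
  have hprob : (volume : Measure UnitAddCircle).real Set.univ = 1 := by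
    simp [Measure.real]
  simp_rw [hre]
  -- For `t ≤ 1/2`, `tanh t / 2 ≤ 1/4`, the weight in `hW`. For `t > 1/2` the trivial bound `t N ≤ 2
  -- t² N` suffices.
  rcases le_or_gt t (1 / 2) with h | h
  · have htanh : Real.tanh t ≤ 1 / 2 := by
      have h1 : Real.exp t * Real.exp t ≤ 3 := by
        rw [← Real.exp_add]
        exact (Real.exp_le_exp.2 (by linarith)).trans (Real.exp_one_lt_three.le)
      have h2 : Real.exp (-t) * Real.exp t = 1 := by rw [← Real.exp_add]; simp
      rw [Real.tanh_eq, div_le_div_iff₀ (by positivity) (by norm_num)]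
      nlinarith [Real.exp_pos t, Real.exp_pos (-t)]
    have htanh0 : 0 ≤ Real.tanh t := by
      rw [Real.tanh_eq_sinh_div_cosh]
      exact div_nonneg (Real.sinh_nonneg_iff.2 ht) (Real.cosh_pos t).le
    calc _ ≤ ∫ x : UnitAddCircle, Real.exp (t ^ 2 * (∑ i, b i) / 2) *
          ∏ i, (1 + 2 * (b i * (Real.tanh t / 2)) * (z * fourier (ν i) x).re) := by
          refine integral_mono (hcont _ (by fun_prop)) (hcont _ (by fun_prop)) fun x => ?_
          exact exp_sum_le_riesz_product hb (hv x) t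
      _ ≤ Real.exp (t ^ 2 * (∑ i, b i) / 2) * 2 := by
          rw [integral_const_mul]
          gcongr
          refine (integral_riesz_product_le ν (fun i => ?_) hz).trans
            ((relationSum_mono (fun i => ?_) fun i => ?_).trans hW)
          · exact mul_nonneg (hb0 i) (by linarith)
          · exact mul_nonneg (hb0 i) (by linarith)
          · nlinarith [hb0 i]
      _ ≤ _ := by
          rw [mul_comm]
          gcongr
          nlinarith [mul_nonneg (sq_nonneg t) hN]
  · calc _ ≤ ∫ x : UnitAddCircle, Real.exp (2 * t ^ 2 * ∑ i, b i) := by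
          refine integral_mono (hcont _ (by fun_prop)) (hcont _ (by fun_prop)) fun x => ?_
          refine Real.exp_le_exp.2 ?_
          have : ∑ i, b i * (z * fourier (ν i) x).re ≤ ∑ i, b i :=
            Finset.sum_le_sum fun i _ => mul_le_of_le_one_right (hb0 i) (le_of_abs_le (hv x i))
          calc _ ≤ t * ∑ i, b i := by gcongr
            _ ≤ _ := by gcongr; nlinarith
      _ ≤ _ := by
          rw [integral_const, hprob, one_smul]
          linarith [Real.exp_pos (2 * t ^ 2 * ∑ i, b i)]

theorem orliczNorm_fourier_sum_le (hb : ∀ i, b i = 0 ∨ b i = 1)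
    (hW : relationSum ν (fun i => b i / 4) ≤ 2) (hN : 0 < ∑ i, b i) :
    orliczNorm gaussOrlicz (volume : Measure UnitAddCircle)
      (fun x => ∑ i, (b i : ℂ) * fourier (ν i) x) ≤ ENNReal.ofReal (8 * √(∑ i, b i)) := by
  have : IsProbabilityMeasure (volume : Measure UnitAddCircle) := ⟨UnitAddCircle.measure_univ⟩
  refine orliczNorm_gaussOrlicz_le (by fun_prop) hN fun z hz t => ?_
  rw [← ofReal_integral_eq_lintegral_ofReal ?_ (ae_of_all _ fun x => (Real.exp_pos _).le)]
  · exact ENNReal.ofReal_le_ofReal (integral_exp_fourier_sum_le hb hW hz t)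
  · exact Continuous.integrable_of_hasCompactSupport (by fun_prop)
      (HasCompactSupport.of_compactSpace _)

end Selectors

/-! ### Crude bounds, for the finitely many exceptional blocks -/

theorem psiNorm_empty : psiNorm ∅ = 0 := by
  refine le_antisymm (ENNReal.le_of_forall_pos_le_add fun r hr _ => ?_) bot_le
  have := orliczNorm_le (Φ := gaussOrlicz) (μ := (volume : Measure UnitAddCircle))
    (f := fun x : UnitAddCircle => ∑ k ∈ (∅ : Finset ℕ), (fourier (k : ℤ) x : ℂ))
    (r := r) (by exact_mod_cast hr) (by simp [gaussOrlicz])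
  simpa [psiNorm] using this

theorem psiNorm_le_two_mul_card (A : Finset ℕ) : psiNorm A ≤ ENNReal.ofReal (2 * A.card) := by
  rcases A.eq_empty_or_nonempty with rfl | hA
  · simp [psiNorm_empty]
  have hc : (0 : ℝ) < A.card := by exact_mod_cast hA.card_pos
  refine orliczNorm_le (by positivity) ?_
  calc _ ≤ ∫⁻ _ : UnitAddCircle, 1 := by
        refine lintegral_mono fun x => ?_
        rw [← ENNReal.ofReal_one]
        refine ENNReal.ofReal_le_ofReal ?_
        have h1 : ‖∑ k ∈ A, (fourier (k : ℤ) x : ℂ)‖ ≤ A.card :=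
          (norm_sum_le _ _).trans (by simp_rw [fourier_apply, Circle.norm_coe]; simp)
        have h2 : ‖∑ k ∈ A, (fourier (k : ℤ) x : ℂ)‖ / (2 * A.card) ≤ 1 / 2 := by
          rw [div_le_div_iff₀ (by positivity) (by norm_num)]; linarith
        have h3 : (‖∑ k ∈ A, (fourier (k : ℤ) x : ℂ)‖ / (2 * A.card)) ^ 2 ≤ (1 / 2) ^ 2 := by
          gcongr
        have h4 : Real.exp (1 / 4) ≤ 2 := by
          have := Real.exp_one_lt_d9
          have h5 : Real.exp (1 / 4) ^ 4 = Real.exp 1 := by rw [← Real.exp_nat_mul]; norm_num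
          by_contra! h6
          have : (2 : ℝ) ^ 4 ≤ Real.exp (1 / 4) ^ 4 := by gcongr
          linarith
        have h5 := Real.exp_le_exp.2 (h3.trans_eq (by norm_num : (1 / 2 : ℝ) ^ 2 = 1 / 4))
        rw [gaussOrlicz]
        linarith
    _ = 1 := by simp


/-! ### Borel–Cantelli, independence and exponential moments -/

section Probability

variable {Ω : Type*} [MeasurableSpace Ω] {P : Measure Ω} [IsProbabilityMeasure P]

theorem ae_eventually_lt_one {X : ℕ → Ω → ℝ} {δ : ℕ → ℝ} (h0 : ∀ n ω, 0 ≤ X n ω)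
    (hint : ∀ n, Integrable (X n) P) (hδ : ∀ n, ∫ ω, X n ω ∂P ≤ δ n) (hs : Summable δ) :
    ∀ᵐ ω ∂P, ∀ᶠ n in atTop, X n ω < 1 := by
  have hle : ∀ n, P {ω | 1 ≤ X n ω} ≤ ENNReal.ofReal (δ n) := by
    intro n
    have := mul_meas_ge_le_integral_of_nonneg (ae_of_all P (h0 n)) (hint n) 1
    rw [one_mul] at this
    rw [← ofReal_measureReal]
    exact ENNReal.ofReal_le_ofReal (this.trans (hδ n))
  have hsum : ∑' n, P {ω | 1 ≤ X n ω} ≠ ∞ :=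
    ne_top_of_le_ne_top hs.tsum_ofReal_ne_top (ENNReal.tsum_le_tsum hle)
  filter_upwards [ae_eventually_notMem hsum] with ω hω
  filter_upwards [hω] with n hn
  simpa using hn

variable {ι : Type*} [Fintype ι] {X : ι → Ω → ℝ}

theorem integral_prod_affine (hX : iIndepFun X P) (hm : ∀ i, Measurable (X i))
    (hint : ∀ i, Integrable (X i) P) (c d : ι → ℝ) :
    ∫ ω, ∏ i, (c i + d i * X i ω) ∂P = ∏ i, (c i + d i * ∫ ω, X i ω ∂P) := by
  have h := (hX.comp (fun i y => c i + d i * y) fun i => by fun_prop).integral_fun_prod_eq_prod_integral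
    fun i => (((hm i).const_mul (d i)).const_add (c i)).aestronglyMeasurable
  simp only [Function.comp_apply] at h
  rw [h]
  refine Finset.prod_congr rfl fun i _ => ?_
  rw [integral_add (integrable_const _) ((hint i).const_mul _), integral_const_mul]
  simp

theorem integrable_of_zero_or_one {Y : Ω → ℝ} (hm : Measurable Y) (h : ∀ ω, Y ω = 0 ∨ Y ω = 1) :
    Integrable Y P :=
  Integrable.of_bound hm.aestronglyMeasurable 1
    (ae_of_all _ fun ω => by rcases h ω with h | h <;> simp [h])

theorem integrable_prod_affine (hm : ∀ i, Measurable (X i)) (h01 : ∀ i ω, X i ω = 0 ∨ X i ω = 1)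
    (c d : ι → ℝ) : Integrable (fun ω => ∏ i, (c i + d i * X i ω)) P := by
  refine Integrable.of_bound (Measurable.aestronglyMeasurable (by fun_prop))
    (∏ i, (|c i| + |d i|)) (ae_of_all _ fun ω => ?_)
  rw [norm_prod]
  refine Finset.prod_le_prod (fun _ _ => norm_nonneg _) fun i _ => ?_
  rcases h01 i ω with h | h
  · simp [h]
  · simpa [h] using abs_add_le (c i) (d i)

omit [MeasurableSpace Ω] in
theorem exp_mul_sum_eq_prod (h01 : ∀ i ω, X i ω = 0 ∨ X i ω = 1) (t : ℝ) (ω : Ω) :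
    Real.exp (t * ∑ i, X i ω) = ∏ i, (1 + (Real.exp t - 1) * X i ω) := by
  rw [Finset.mul_sum, Real.exp_sum]
  refine Finset.prod_congr rfl fun i _ => ?_
  rcases h01 i ω with h | h <;> simp [h]

theorem integrable_exp_mul_sum (hm : ∀ i, Measurable (X i)) (h01 : ∀ i ω, X i ω = 0 ∨ X i ω = 1)
    (t : ℝ) : Integrable (fun ω => Real.exp (t * ∑ i, X i ω)) P := by
  simp_rw [exp_mul_sum_eq_prod h01]
  exact integrable_prod_affine hm h01 _ _

theorem integral_exp_mul_sum_le (hX : iIndepFun X P) (hm : ∀ i, Measurable (X i))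
    (h01 : ∀ i ω, X i ω = 0 ∨ X i ω = 1) (t : ℝ) :
    ∫ ω, Real.exp (t * ∑ i, X i ω) ∂P ≤
      Real.exp ((Real.exp t - 1) * ∑ i, ∫ ω, X i ω ∂P) := by
  simp_rw [exp_mul_sum_eq_prod h01]
  rw [integral_prod_affine hX hm (fun i => integrable_of_zero_or_one (hm i) (h01 i)),
    Finset.mul_sum, Real.exp_sum]
  have hp : ∀ i, 0 ≤ ∫ ω, X i ω ∂P := fun i =>
    integral_nonneg fun ω => by rcases h01 i ω with h | h <;> simp [h]
  have hp1 : ∀ i, ∫ ω, X i ω ∂P ≤ 1 := fun i => by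
    calc _ ≤ ∫ _, (1 : ℝ) ∂P := integral_mono (integrable_of_zero_or_one (hm i) (h01 i))
          (integrable_const _) fun ω => by rcases h01 i ω with h | h <;> simp [h]
      _ = 1 := by simp
  refine Finset.prod_le_prod (fun i _ => ?_) fun i _ => ?_
  · nlinarith [hp i, hp1 i, Real.exp_pos t, mul_nonneg (hp i) (Real.exp_pos t).le]
  · rw [add_comm]; exact Real.add_one_le_exp _

variable [DecidableEq ι]

omit [DecidableEq ι] in
theorem ite_eq_affine (ε : ι → SignType) (y : ι → ℝ) :
    ∏ i, (if ε i = 0 then 1 else y i / 4) =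
      ∏ i, ((if ε i = 0 then 1 else 0) + (if ε i = 0 then 0 else 1 / 4) * y i) :=
  Finset.prod_congr rfl fun i _ => by split_ifs <;> ring

theorem integrable_relationSum (hm : ∀ i, Measurable (X i))
    (h01 : ∀ i ω, X i ω = 0 ∨ X i ω = 1) (ν : ι → ℤ) :
    Integrable (fun ω => relationSum ν fun i => X i ω / 4) P := by
  simp_rw [relationSum, ite_eq_affine]
  exact integrable_finsetSum _ fun ε _ => integrable_prod_affine hm h01 _ _

/-- Each summand is a product of affine functions of distinct independent variables, so the
expectation passes to the weights. -/
theorem integral_relationSum (hX : iIndepFun X P) (hm : ∀ i, Measurable (X i))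
    (h01 : ∀ i ω, X i ω = 0 ∨ X i ω = 1) (ν : ι → ℤ) :
    ∫ ω, relationSum ν (fun i => X i ω / 4) ∂P =
      relationSum ν (fun i => (∫ ω, X i ω ∂P) / 4) := by
  simp_rw [relationSum, ite_eq_affine]
  rw [integral_finsetSum _ fun ε _ => integrable_prod_affine hm h01 _ _]
  exact Finset.sum_congr rfl fun ε _ =>
    integral_prod_affine hX hm (fun i => integrable_of_zero_or_one (hm i) (h01 i)) _ _

end Probability

/-! ### Estimates on dyadic blocks -/

section Blocks

/-- The `n`-th dyadic block `[2 ^ n, 2 ^ (n + 1))` as a type. -/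
abbrev DyadicBlock (n : ℕ) : Type := {k : ℕ // k ∈ Finset.Ico (2 ^ n) (2 ^ (n + 1))}

theorem DyadicBlock.one_le {n : ℕ} (i : DyadicBlock n) : 1 ≤ (i : ℕ) :=
  Nat.one_le_two_pow.trans (Finset.mem_Ico.1 i.2).1

theorem card_dyadicBlock (n : ℕ) : (Fintype.card (DyadicBlock n) : ℝ) = 2 ^ n := by
  rw [Fintype.card_coe, Nat.card_Ico, pow_succ, Nat.mul_two, Nat.add_sub_cancel]
  simp

theorem log_div_le {n : ℕ} (i : DyadicBlock n) :
    Real.log (i : ℕ) / (i : ℕ) ≤ (n + 1) * Real.log 2 / 2 ^ n := by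
  have h1 : ((2 : ℝ) ^ n) ≤ (i : ℕ) := by exact_mod_cast (Finset.mem_Ico.1 i.2).1
  have h2 : ((i : ℕ) : ℝ) ≤ 2 ^ (n + 1) := by exact_mod_cast (Finset.mem_Ico.1 i.2).2.le
  have h0 : (0 : ℝ) < (i : ℕ) := lt_of_lt_of_le (by positivity) h1
  have hl : Real.log (i : ℕ) ≤ (n + 1) * Real.log 2 := by
    calc _ ≤ Real.log (2 ^ (n + 1)) := Real.log_le_log h0 h2
      _ = _ := by rw [Real.log_pow]; push_cast; ring
  have := Real.log_pos one_lt_two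
  gcongr

theorem le_log_div {n : ℕ} (i : DyadicBlock n) :
    n * Real.log 2 / 2 ^ (n + 1) ≤ Real.log (i : ℕ) / (i : ℕ) := by
  have h1 : ((2 : ℝ) ^ n) ≤ (i : ℕ) := by exact_mod_cast (Finset.mem_Ico.1 i.2).1
  have h2 : ((i : ℕ) : ℝ) ≤ 2 ^ (n + 1) := by exact_mod_cast (Finset.mem_Ico.1 i.2).2.le
  have h0 : (0 : ℝ) < (i : ℕ) := lt_of_lt_of_le (by positivity) h1
  have hl : n * Real.log 2 ≤ Real.log (i : ℕ) := by
    calc _ = Real.log (2 ^ n) := by rw [Real.log_pow]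
      _ ≤ _ := Real.log_le_log (by positivity) h1
  have := Real.log_pos one_lt_two
  have : (0 : ℝ) ≤ n * Real.log 2 := by positivity
  gcongr

theorem sum_log_div_le (n : ℕ) :
    ∑ i : DyadicBlock n, Real.log (i : ℕ) / (i : ℕ) ≤ (n + 1) * Real.log 2 := by
  calc _ ≤ ∑ i : DyadicBlock n, (n + 1) * Real.log 2 / 2 ^ n :=
        Finset.sum_le_sum fun i _ => log_div_le i
    _ = _ := by
        rw [Finset.sum_const, Finset.card_univ, nsmul_eq_mul, card_dyadicBlock]
        field_simp

theorem le_sum_log_div (n : ℕ) :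
    n * Real.log 2 / 2 ≤ ∑ i : DyadicBlock n, Real.log (i : ℕ) / (i : ℕ) := by
  calc _ = ∑ i : DyadicBlock n, n * Real.log 2 / 2 ^ (n + 1) := by
        rw [Finset.sum_const, Finset.card_univ, nsmul_eq_mul, card_dyadicBlock]
        field_simp
        ring
    _ ≤ _ := Finset.sum_le_sum fun i _ => le_log_div i

variable {Ω : Type*} {ξ : ℕ → Ω → ℝ} {ω : Ω}

theorem sum_blockPart_randomSet {M : Type*} [AddCommMonoid M] [Module ℝ M]
    (h01 : ∀ k, 1 ≤ k → ξ k ω = 0 ∨ ξ k ω = 1) (n : ℕ) (g : ℕ → M) :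
    ∑ k ∈ blockPart (randomSet ξ ω) n, g k = ∑ i : DyadicBlock n, ξ i ω • g i := by
  classical
  rw [blockPart, Finset.sum_filter, ← Finset.sum_coe_sort]
  refine Finset.sum_congr rfl fun i _ => ?_
  have := DyadicBlock.one_le i
  rcases h01 i this with h | h <;> simp [randomSet, h, this]

theorem card_blockPart_randomSet (h01 : ∀ k, 1 ≤ k → ξ k ω = 0 ∨ ξ k ω = 1) (n : ℕ) :
    ((blockPart (randomSet ξ ω) n).card : ℝ) = ∑ i : DyadicBlock n, ξ i ω := by
  simpa using sum_blockPart_randomSet h01 n (fun _ => (1 : ℝ))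

variable [MeasurableSpace Ω] {P : Measure Ω}

theorem IsLogSelectors.indep_block (hξ : IsLogSelectors P ξ) (n : ℕ) :
    iIndepFun (fun i : DyadicBlock n => ξ i) P :=
  hξ.indep.precomp (g := fun i : DyadicBlock n => (⟨i, i.one_le⟩ : {k : ℕ // 1 ≤ k}))
    fun _ _ h => Subtype.ext (Subtype.mk.inj h)

variable [IsProbabilityMeasure P]

theorem IsLogSelectors.ae_eventually_relationSum_le (hξ : IsLogSelectors P ξ) :
    ∀ᵐ ω ∂P, ∀ᶠ n in atTop,
      relationSum (fun i : DyadicBlock n => ((i : ℕ) : ℤ)) (fun i => ξ i ω / 4) ≤ 2 := by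
  have hm : ∀ n, ∀ i : DyadicBlock n, Measurable (ξ i) := fun n i => hξ.measurable i i.one_le
  have h01 : ∀ n, ∀ (i : DyadicBlock n) ω, ξ i ω = 0 ∨ ξ i ω = 1 :=
    fun n i => hξ.zero_or_one i i.one_le
  have hsum : Summable fun n : ℕ => ((n : ℝ) + 1) * Real.exp (-(1 / 4) * n) := by
    have h1 := Real.summable_pow_mul_exp_neg_nat_mul 1 (r := 1 / 4) (by norm_num)
    have h2 := Real.summable_pow_mul_exp_neg_nat_mul 0 (r := 1 / 4) (by norm_num)
    refine (h1.add h2).congr fun n => by simp; ring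
  have h := ae_eventually_lt_one (P := P) (X := fun n ω =>
      relationSum (fun i : DyadicBlock n => ((i : ℕ) : ℤ)) (fun i => ξ i ω / 4) - 1)
    (δ := fun n => (n + 1) * Real.exp (-(1 / 4) * n)) ?_ ?_ ?_ hsum
  · filter_upwards [h] with ω hω
    filter_upwards [hω] with n hn
    linarith
  · intro n ω
    refine sub_nonneg.2 (one_le_relationSum fun i => ?_)
    rcases h01 n i ω with h | h <;> simp [h]
  · exact fun n => (integrable_relationSum (hm n) (h01 n) _).sub (integrable_const _)
  · intro n
    rw [integral_sub (integrable_relationSum (hm n) (h01 n) _) (integrable_const _),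
      integral_relationSum (hξ.indep_block n) (hm n) (h01 n)]
    simp_rw [hξ.mean _ (DyadicBlock.one_le _)]
    have hl := Real.log_pos one_lt_two
    have hl1 := Real.log_two_gt_d9
    have hl2 := Real.log_two_lt_d9
    have hpos : ∀ i : DyadicBlock n, 0 ≤ Real.log (i : ℕ) / (i : ℕ) := fun i =>
      div_nonneg (Real.log_natCast_nonneg _) (Nat.cast_nonneg _)
    have hle := relationSum_le (ν := fun i : DyadicBlock n => ((i : ℕ) : ℤ))
      (w := fun i => Real.log (i : ℕ) / (i : ℕ) / 4) (q := (n + 1) * Real.log 2 / 2 ^ n / 4)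
      (fun i j h => Subtype.ext (Int.ofNat_inj.1 h))
      (fun i => by exact_mod_cast i.one_le) (fun i => by have := hpos i; positivity)
      (fun i => by have := log_div_le i; gcongr) (by positivity)
    have hprod : ∏ i : DyadicBlock n, (1 + 2 * (Real.log (i : ℕ) / (i : ℕ) / 4)) ≤
        Real.exp ((n + 1) * Real.log 2 / 2) := by
      calc _ ≤ ∏ i : DyadicBlock n, Real.exp (Real.log (i : ℕ) / (i : ℕ) / 2) := by
            refine Finset.prod_le_prod (fun i _ => by have := hpos i; positivity) fun i _ => ?_
            refine le_trans (le_of_eq (by ring)) (Real.add_one_le_exp _)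
        _ = Real.exp ((∑ i : DyadicBlock n, Real.log (i : ℕ) / (i : ℕ)) / 2) := by
            rw [← Real.exp_sum, Finset.sum_div]
        _ ≤ _ := by have := sum_log_div_le n; gcongr
    have hpow : (2 : ℝ) ^ n = Real.exp (n * Real.log 2) := by
      rw [Real.exp_nat_mul, Real.exp_log two_pos]
    calc _ ≤ (n + 1) * Real.log 2 / 2 ^ n / 4 * Real.exp ((n + 1) * Real.log 2 / 2) := by
          have := mul_le_mul_of_nonneg_left hprod
            (show 0 ≤ (n + 1) * Real.log 2 / 2 ^ n / 4 by positivity)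
          simp only [integral_const, probReal_univ, one_smul]
          linarith
      _ = (n + 1) * (Real.log 2 / 4) * Real.exp ((n + 1) * Real.log 2 / 2 - n * Real.log 2) := by
          rw [hpow, Real.exp_sub]; field_simp
      -- The exponent is `(1 - n) * log 2 / 2`, and `log 2 / 2 > 1/4`.
      _ ≤ (n + 1) * (Real.log 2 / 4) * Real.exp (1 + -(1 / 4) * n) := by
          gcongr
          nlinarith [(Nat.cast_nonneg n : (0 : ℝ) ≤ n)]
      _ = (n + 1) * Real.exp (-(1 / 4) * n) * (Real.log 2 / 4 * Real.exp 1) := by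
          rw [Real.exp_add]; ring
      _ ≤ (n + 1) * Real.exp (-(1 / 4) * n) * 1 := by
          gcongr
          nlinarith [Real.exp_one_lt_three, Real.exp_pos 1]
      _ = _ := mul_one _

/-- Chernoff and Borel–Cantelli: the slack `r` leaves a summable `exp (C - r n)`. The sign of `t`
selects the upper or the lower tail. -/
theorem IsLogSelectors.ae_eventually_mul_sum_lt (hξ : IsLogSelectors P ξ) {t c C r : ℝ} (hr : 0 < r)
    (h : ∀ n : ℕ, (Real.exp t - 1) * ∑ i : DyadicBlock n, Real.log (i : ℕ) / (i : ℕ) ≤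
      C + (c - r) * n) :
    ∀ᵐ ω ∂P, ∀ᶠ n : ℕ in atTop, t * ∑ i : DyadicBlock n, ξ i ω < c * n := by
  have hm : ∀ n, ∀ i : DyadicBlock n, Measurable (ξ i) := fun n i => hξ.measurable i i.one_le
  have h01 : ∀ n, ∀ (i : DyadicBlock n) ω, ξ i ω = 0 ∨ ξ i ω = 1 :=
    fun n i => hξ.zero_or_one i i.one_le
  have hsum : Summable fun n : ℕ => Real.exp C * Real.exp (-r * n) := by
    have h2 := Real.summable_pow_mul_exp_neg_nat_mul 0 hr
    exact (h2.mul_left (Real.exp C)).congr fun n => by simp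
  have key := ae_eventually_lt_one (P := P) (X := fun n ω =>
      Real.exp (t * ∑ i : DyadicBlock n, ξ i ω) * Real.exp (-(c * n))) (fun n ω => by positivity)
    (fun n => (integrable_exp_mul_sum (hm n) (h01 n) t).mul_const _) (fun n => ?_) hsum
  · filter_upwards [key] with ω hω
    filter_upwards [hω] with n hn
    rw [← Real.exp_add, Real.exp_lt_one_iff] at hn
    linarith
  · rw [integral_mul_const]
    have h1 := integral_exp_mul_sum_le (hξ.indep_block n) (hm n) (h01 n) t
    simp_rw [hξ.mean _ (DyadicBlock.one_le _)] at h1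
    calc _ ≤ Real.exp (C + (c - r) * n) * Real.exp (-(c * n)) := by
          gcongr
          exact h1.trans (Real.exp_le_exp.2 (h n))
      _ = _ := by rw [← Real.exp_add, ← Real.exp_add]; ring_nf

end Blocks

/-! ### Assembly -/

theorem theorem5p5 {Ω : Type*} [MeasurableSpace Ω] (P : Measure Ω) [IsProbabilityMeasure P]
    (ξ : ℕ → Ω → ℝ) (hξ : IsLogSelectors P ξ) :
    ∀ᵐ ω ∂P,
      ((fun n : ℕ => ((blockPart (randomSet ξ ω) n).card : ℝ)) =Θ[atTop] (fun n : ℕ => (n : ℝ))) ∧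
      ∃ C : ℝ, 0 < C ∧ ∀ n : ℕ,
        psiNorm (blockPart (randomSet ξ ω) n) ≤
          ENNReal.ofReal (C * Real.sqrt ((blockPart (randomSet ξ ω) n).card : ℝ)) := by
  have hl1 := Real.log_two_gt_d9
  have hl2 := Real.log_two_lt_d9
  have hupper := hξ.ae_eventually_mul_sum_lt (t := 1) (c := 3) (C := 2) (r := 1) one_pos
    (fun n => by
      have h1 := sum_log_div_le n
      have h2 := Real.exp_one_lt_three
      have h3 := Real.exp_one_gt_two
      have h4 : (0 : ℝ) ≤ n := Nat.cast_nonneg n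
      calc _ ≤ (Real.exp 1 - 1) * ((n + 1) * Real.log 2) := by gcongr; linarith
        _ ≤ 2 * ((n + 1) * 1) := by gcongr <;> linarith
        _ = _ := by ring)
  -- Here `(exp (-1) - 1) * (n log 2 / 2) ≤ -(log 2 / 4) n`, and `log 2 / 4 > 3/20 = 1/10 + 1/20`.
  have hlower := hξ.ae_eventually_mul_sum_lt (t := -1) (c := -(1 / 10)) (C := 0) (r := 1 / 20)
    (by norm_num)
    (fun n => by
      have h1 := le_sum_log_div n
      have h2 : Real.exp (-1) ≤ 1 / 2 := by
        rw [Real.exp_neg, one_div]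
        exact inv_anti₀ two_pos Real.exp_one_gt_two.le
      have h4 : (0 : ℝ) ≤ n := Nat.cast_nonneg n
      have h5 : 0 ≤ ∑ i : DyadicBlock n, Real.log (i : ℕ) / (i : ℕ) :=
        le_trans (by positivity) h1
      nlinarith)
  filter_upwards [hupper, hlower, hξ.ae_eventually_relationSum_le] with ω hu hl hW
  have h01 : ∀ k, 1 ≤ k → ξ k ω = 0 ∨ ξ k ω = 1 := fun k hk => hξ.zero_or_one k hk ω
  have hcard := card_blockPart_randomSet h01
  constructor
  · constructor
    · refine IsBigO.of_bound 3 ?_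
      filter_upwards [hu] with n hn
      rw [Real.norm_natCast, Real.norm_natCast, hcard]
      linarith
    · refine IsBigO.of_bound 10 ?_
      filter_upwards [hl] with n hn
      rw [Real.norm_natCast, Real.norm_natCast, hcard]
      linarith
  · obtain ⟨n₀, hn₀⟩ := eventually_atTop.1 hW
    -- The 8 serves the blocks `n ≥ n₀`; `2 * 2 ^ n₀` covers the earlier ones, which have at most `2
    -- ^ n₀` elements.
    refine ⟨8 + 2 * 2 ^ n₀, by positivity, fun n => ?_⟩
    set A := blockPart (randomSet ξ ω) n with hA
    rcases A.eq_empty_or_nonempty with h | h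
    · simp [h, psiNorm_empty]
    have hpos : (1 : ℝ) ≤ A.card := by exact_mod_cast h.card_pos
    have hsq : (1 : ℝ) ≤ √A.card := Real.one_le_sqrt.2 hpos
    rcases le_or_gt n₀ n with hn | hn
    · have key := orliczNorm_fourier_sum_le (ν := fun i : DyadicBlock n => ((i : ℕ) : ℤ))
        (b := fun i => ξ i ω) (fun i => h01 i i.one_le) (hn₀ n hn) (by rw [← hcard]; linarith)
      rw [← hcard] at key
      have hf : (fun x : UnitAddCircle => ∑ k ∈ A, (fourier (k : ℤ) x : ℂ)) =
          fun x => ∑ i : DyadicBlock n, (ξ i ω : ℂ) * fourier ((i : ℕ) : ℤ) x := by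
        funext x
        rw [hA, sum_blockPart_randomSet h01 n (fun k => (fourier (k : ℤ) x : ℂ))]
        simp only [Complex.real_smul]
      rw [psiNorm, hf]
      refine key.trans (ENNReal.ofReal_le_ofReal ?_)
      gcongr
      linarith [pow_pos (two_pos (α := ℝ)) n₀]
    · refine (psiNorm_le_two_mul_card A).trans (ENNReal.ofReal_le_ofReal ?_)
      have hle : (A.card : ℝ) ≤ 2 ^ n₀ := by
        have h1 : A.card ≤ 2 ^ n := by
          have h2 : A ⊆ Finset.Ico (2 ^ n) (2 ^ (n + 1)) := by
            classical
            exact fun k hk => (Finset.mem_filter.1 hk).1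
          refine (Finset.card_le_card h2).trans_eq ?_
          rw [Nat.card_Ico, pow_succ, Nat.mul_two, Nat.add_sub_cancel]
        calc (A.card : ℝ) ≤ 2 ^ n := by exact_mod_cast h1
          _ ≤ 2 ^ n₀ := pow_le_pow_right₀ one_le_two hn.le
      calc (2 * A.card : ℝ) ≤ 8 + 2 * 2 ^ n₀ := by linarith
        _ ≤ _ := le_mul_of_one_le_right (by positivity) hsq
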